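/- Let $S_n$ be the set of permutations of $\{1,\dots,n\}$. For $\pi\in S_n$ let $\mathrm{fp}(\pi)$, $\mathrm{exc}(\pi)$, $\mathrm{dexc}(\pi)$, $\mathrm{cyc}(\pi)$, $\mathrm{inv}(\pi)$ be, respectively, the number of $i$ with $\pi(i)=i$, of $i$ with $i<\pi(i)$, of $i$ with $i<\pi(i)<\pi(\pi(i))$, of cycles (fixed points included), and of inversions of $\pi$. Say that $\pi$ has *noncrossing cycles* if there are no $i<j<k<l$ such that $i,k$ belong to one cycle of $\pi$ and $j,l$ to another; that a cycle is *unimodal* if, written with its smallest element first as $(a_1,\dots,a_k)$, it satisfies $a_1<\dots<a_i>\dots>a_k$ for some $1\le i\le k$; and that a fixed point $j$ is *nested* if there are $i<j<k$ with $\pi(i)=k$ or $\pi(k)=i$. Let $U_n\subseteq S_n$ be the set of permutations all of whose cycles are unimodal, that have noncrossing cycles, and that have no nested fixed point. Then: 1. $|U_n|=C_n=\frac1{n+1}\binom{2n}{n}$ for every $n\ge0$. 2. For every $n\ge 0$, the joint distribution of $(\mathrm{fp},\mathrm{exc},\mathrm{dexc})$ on $U_n$ equals its joint distribution on the set of $321$-avoiding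 permutations in $S_n$ (those without a decreasing subsequence of length $3$). 3. As formal power series in $z$, $$\sum_{n\ge0}\sum_{\pi\in U_n} x^{\mathrm{fp}(\pi)}v^{\mathrm{exc}(\pi)}w^{\mathrm{dexc}(\pi)}t^{\mathrm{cyc}(\pi)}q^{\mathrm{inv}(\pi)}z^n=\cfrac{1}{1-\ell_0z-\cfrac{d_1z^2}{1-\ell_1z-\cfrac{d_2z^2}{1-\ell_2z-\cdots}}},$$ where $\ell_0=xt$, and $d_h=vt\,q^{4h-3}$ and $\ell_h=(1+vw)\,q^{2h-1}$ for $h\ge1$. -/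

import Mathlib

namespace PermCycles

section Permutations

variable {n : ℕ}

/-- Number of fixed points of `π`. -/
def fp (π : Equiv.Perm (Fin n)) : ℕ :=
  (Finset.univ.filter fun i : Fin n => π i = i).card

/-- Number of excedances of `π`: positions `i` with `i < π i`. -/
def exc (π : Equiv.Perm (Fin n)) : ℕ :=
  (Finset.univ.filter fun i : Fin n => i < π i).card

/-- Number of double excedances of `π`: positions `i` with `i < π i < π (π i)`. -/
def dexc (π : Equiv.Perm (Fin n)) : ℕ :=
  (Finset.univ.filter fun i : Fin n => i < π i ∧ π i < π (π i)).card

/-- Number of cycles of `π`, where each fixed point counts as a cycle. -/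
noncomputable def cyc (π : Equiv.Perm (Fin n)) : ℕ :=
  Nat.card (Quotient (Equiv.Perm.SameCycle.setoid π))

/-- Number of inversions of `π`: pairs `i < j` with `π i > π j`. -/
def inv (π : Equiv.Perm (Fin n)) : ℕ :=
  (Finset.univ.filter fun p : Fin n × Fin n => p.1 < p.2 ∧ π p.2 < π p.1).card

/-- There are no `i < j < k < l` such that `i, k` belong to one cycle and `j, l` to another. -/
def NoncrossingCycles (π : Equiv.Perm (Fin n)) : Prop :=
  ¬ ∃ i j k l : Fin n, i < j ∧ j < k ∧ k < l ∧
    π.SameCycle i k ∧ π.SameCycle j l ∧ ¬ π.SameCycle i j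

/-- The cycle of `π` through `a`, written `(a, π a, π² a, …)` starting with `a`, increases up to
some position `m` (counted from `0`) and decreases from there to its last entry. The length of
the cycle is the minimal period of `a` under `π`. -/
def UnimodalFrom (π : Equiv.Perm (Fin n)) (a : Fin n) : Prop :=
  ∃ m < Function.minimalPeriod π a,
    (∀ s, s < m → (π ^ s) a < (π ^ (s + 1)) a) ∧
    (∀ s, m ≤ s → s + 1 < Function.minimalPeriod π a → (π ^ (s + 1)) a < (π ^ s) a)

/-- Every cycle of `π`, written with its smallest element first, is unimodal. -/
def UnimodalCycles (π : Equiv.Perm (Fin n)) : Prop :=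
  ∀ a : Fin n, (∀ b, π.SameCycle a b → a ≤ b) → UnimodalFrom π a

/-- A fixed point `j` of `π` is nested if there are `i < j < k` with `π i = k` or `π k = i`. -/
def IsNestedFixedPoint (π : Equiv.Perm (Fin n)) (j : Fin n) : Prop :=
  π j = j ∧ ∃ i k : Fin n, i < j ∧ j < k ∧ (π i = k ∨ π k = i)

/-- `π` has no decreasing subsequence of length three. -/
def Avoids321 (π : Equiv.Perm (Fin n)) : Prop :=
  ¬ ∃ i j k : Fin n, i < j ∧ j < k ∧ π k < π j ∧ π j < π i

end Permutations

open Classical in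
/-- The permutations of an `n`-element chain with unimodal noncrossing cycles and no nested fixed
points. -/
noncomputable def unimodalNoncrossing (n : ℕ) : Finset (Equiv.Perm (Fin n)) :=
  Finset.univ.filter fun π =>
    UnimodalCycles π ∧ NoncrossingCycles π ∧ ∀ j, ¬ IsNestedFixedPoint π j

open Classical in
/-- The `321`-avoiding permutations of an `n`-element chain. -/
noncomputable def avoiding321 (n : ℕ) : Finset (Equiv.Perm (Fin n)) :=
  Finset.univ.filter fun π => Avoids321 π

section JFraction

variable {R : Type*} [CommRing R]

/-- Finite convergents: `jConvergent d l N h` is the finite continued fraction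
`1 / (1 - l h z - d (h+1) z² / (1 - l (h+1) z - ⋯ - d (h+N) z² / (1 - l (h+N) z)))`
as a formal power series in `z`. All denominators have constant coefficient `1`. -/
noncomputable def jConvergent (d l : ℕ → R) : ℕ → ℕ → PowerSeries R
  | 0, h => PowerSeries.invOfUnit (1 - PowerSeries.C (l h) * PowerSeries.X) 1
  | N + 1, h => PowerSeries.invOfUnit
      (1 - PowerSeries.C (l h) * PowerSeries.X
        - PowerSeries.C (d (h + 1)) * PowerSeries.X ^ 2 * jConvergent d l N (h + 1)) 1

/-- The infinite continued fraction
`1 / (1 - l 0 z - d 1 z² / (1 - l 1 z - d 2 z² / (1 - l 2 z - ⋯)))`: the limit of its convergents,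
whose coefficient of `z ^ n` is the same in all convergents from the `n`-th on
(see `coeff_jConvergent`). The value `d 0` is not used. -/
noncomputable def jFraction (d l : ℕ → R) : PowerSeries R :=
  PowerSeries.mk fun n => PowerSeries.coeff n (jConvergent d l n 0)

theorem invOfUnit_sub_dvd {a b c : PowerSeries R}
    (ha : PowerSeries.constantCoeff a = 1) (hb : PowerSeries.constantCoeff b = 1)
    (h : c ∣ a - b) : c ∣ PowerSeries.invOfUnit a 1 - PowerSeries.invOfUnit b 1 := by
  have h1 : a * PowerSeries.invOfUnit a 1 = 1 := PowerSeries.mul_invOfUnit a 1 (by simpa using ha)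
  have h2 : b * PowerSeries.invOfUnit b 1 = 1 := PowerSeries.mul_invOfUnit b 1 (by simpa using hb)
  obtain ⟨e, he⟩ := h
  refine ⟨-(PowerSeries.invOfUnit a 1 * PowerSeries.invOfUnit b 1 * e), ?_⟩
  linear_combination (PowerSeries.invOfUnit b 1) * h1 - (PowerSeries.invOfUnit a 1) * h2
    - PowerSeries.invOfUnit a 1 * PowerSeries.invOfUnit b 1 * he

theorem jConvergent_sub_dvd (d l : ℕ → R) (N M h : ℕ) (hNM : N ≤ M) :
    PowerSeries.X ^ (2 * N + 2) ∣ jConvergent d l M h - jConvergent d l N h := by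
  induction N generalizing M h with
  | zero =>
    cases M with
    | zero => simp
    | succ M =>
      rw [jConvergent, jConvergent]
      refine invOfUnit_sub_dvd (by simp) (by simp)
        ⟨-(PowerSeries.C (d (h + 1)) * jConvergent d l M (h + 1)), by ring⟩
  | succ N ih =>
    cases M with
    | zero => omega
    | succ M =>
      rw [jConvergent, jConvergent]
      obtain ⟨e, he⟩ := ih M (h + 1) (by omega)
      refine invOfUnit_sub_dvd (by simp) (by simp) ⟨-(PowerSeries.C (d (h + 1)) * e), ?_⟩
      linear_combination -(PowerSeries.C (d (h + 1)) * PowerSeries.X ^ 2) * he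

/-- The convergents converge coefficientwise to the infinite continued fraction. -/
theorem coeff_jConvergent (d l : ℕ → R) (n N : ℕ) (h : n ≤ N) :
    PowerSeries.coeff n (jConvergent d l N 0) = PowerSeries.coeff n (jFraction d l) := by
  have h1 := PowerSeries.X_pow_dvd_iff.1 (jConvergent_sub_dvd d l n N 0 h) n (by omega)
  rw [map_sub, sub_eq_zero] at h1
  rw [h1, jFraction, PowerSeries.coeff_mk]

end JFraction

end PermCycles

open PermCycles

/-! Draw each excedance as an upper arc from `i` to `π i` and each anti-excedance as a lower arc.
`word π` records only which arc ends meet at each point, so it traces a Motzkin path whose height at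
a gap is the number of upper arcs over it. Without nested fixed points, fixed points occur only at
height zero (`validWord_word_iff`).

A word leaves open how arc starts are matched to arc ends. First in, first out on both sides gives
the `321`-avoiding permutations (`mem_avoiding321_iff`). Last in, first out gives the unimodal
noncrossing ones (`mem_unimodalNoncrossing_iff`), because then the cycles can be read off the levels
of the path. Each rule has exactly one matching per valid word, so both classes biject with
`validWords`. Since `fp`, `exc` and `dexc` depend only on the word, part 2 follows.

On the last-in-first-out side, `cyc` and `inv` are also sums over letters (`cyc_eq_card_word`,
`inv_eq_sum_word`). The generating function is thus a weighted count of Motzkin paths, and cutting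
paths at the descents below each level gives the continued fraction. With all weights `1`, the same
first-letter recurrence is solved by powers of the Catalan series. -/

namespace PermCycles
open Finset

/-! ### Words of permutations and the two matching rules -/

section Words

variable {n : ℕ}

/-- Letters recording the local shape of a permutation at a point `i`: `none` for a fixed point,
and otherwise `some (p, q)` where `p` says whether `i` is an excedance and `q` whether `i` is an
excedance value. -/
abbrev Letter := Option (Bool × Bool)

/-- The change of height along a letter. -/
def Letter.rise : Letter → ℤ
  | none => 0
  | some (p, q) => (if p then 1 else 0) - (if q then 1 else 0)

/-- The height of a word before its position `p`. -/
def wordHeight (w : Fin n → Letter) (p : ℕ) : ℤ :=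
  ∑ j : Fin n, if (j : ℕ) < p then (w j).rise else 0

/-- The word of local shapes of a permutation. -/
def word (π : Equiv.Perm (Fin n)) (i : Fin n) : Letter :=
  if π i = i then none else some (decide (i < π i), decide (π⁻¹ i < i))

/-- The number of excedances of `π` that jump over the gap before `p`. -/
def upArcs (π : Equiv.Perm (Fin n)) (p : ℕ) : ℕ :=
  #{i : Fin n | (i : ℕ) < p ∧ p ≤ (π i : ℕ)}

theorem perm_inv_apply_self (π : Equiv.Perm (Fin n)) (i : Fin n) : π⁻¹ (π i) = i :=
  π.symm_apply_apply i

theorem perm_apply_inv_self (π : Equiv.Perm (Fin n)) (i : Fin n) : π (π⁻¹ i) = i :=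
  π.apply_symm_apply i

theorem inv_apply_eq_self_iff (π : Equiv.Perm (Fin n)) (i : Fin n) : π⁻¹ i = i ↔ π i = i := by
  rw [Equiv.Perm.inv_eq_iff_eq, eq_comm]

theorem rise_word (π : Equiv.Perm (Fin n)) (i : Fin n) :
    (word π i).rise = (if i < π i then 1 else 0) - (if π⁻¹ i < i then 1 else 0) := by
  have h := inv_apply_eq_self_iff π i
  unfold word
  by_cases hi : π i = i
  · rw [if_pos hi, hi, h.2 hi]; simp [Letter.rise]
  · rw [if_neg hi]; simp only [Letter.rise, decide_eq_true_eq]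

theorem rise_word_inv (π : Equiv.Perm (Fin n)) (i : Fin n) :
    (word π⁻¹ i).rise = (word π i).rise := by
  have h := inv_apply_eq_self_iff π i
  rw [rise_word, rise_word, inv_inv]
  split_ifs <;> first | rfl | omega

/-- Reindexing by `π` charges each arc end to the excedance it closes, so only arcs opened but not
closed before `p` survive. -/
theorem wordHeight_word (π : Equiv.Perm (Fin n)) (p : ℕ) :
    wordHeight (word π) p = upArcs π p := by
  have h1 : ∑ j : Fin n, (if (j : ℕ) < p then (if π⁻¹ j < j then (1 : ℤ) else 0) else 0) =
      ∑ j : Fin n, (if (π j : ℕ) < p then (if j < π j then (1 : ℤ) else 0) else 0) := by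
    rw [← Equiv.sum_comp π]
    simp
  have h2 : wordHeight (word π) p =
      ∑ j : Fin n, (if (j : ℕ) < p then (if j < π j then (1 : ℤ) else 0) else 0) -
      ∑ j : Fin n, (if (j : ℕ) < p then (if π⁻¹ j < j then (1 : ℤ) else 0) else 0) := by
    rw [wordHeight, ← sum_sub_distrib]
    refine sum_congr rfl fun j _ => ?_
    rw [rise_word]
    split_ifs <;> simp
  rw [h2, h1, ← sum_sub_distrib, upArcs, card_filter, Nat.cast_sum]
  refine sum_congr rfl fun j _ => ?_
  simp only [Fin.lt_def]
  split_ifs <;> omega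

/-- Inversion preserves every rise. This is the balance of rightward and leftward moves over a gap,
and it lets each statement on upper arcs be reused for lower arcs. -/
theorem upArcs_inv (π : Equiv.Perm (Fin n)) (p : ℕ) : upArcs π⁻¹ p = upArcs π p := by
  have h : wordHeight (word π⁻¹) p = wordHeight (word π) p :=
    sum_congr rfl fun j _ => by rw [rise_word_inv]
  rw [wordHeight_word, wordHeight_word] at h
  exact_mod_cast h

theorem upArcs_pos_iff (π : Equiv.Perm (Fin n)) (p : ℕ) :
    0 < upArcs π p ↔ ∃ i : Fin n, (i : ℕ) < p ∧ p ≤ (π i : ℕ) := by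
  rw [upArcs, card_pos]
  exact ⟨fun ⟨i, hi⟩ => ⟨i, by simpa using hi⟩, fun ⟨i, hi⟩ => ⟨i, by simpa using hi⟩⟩

theorem downArcs_eq (π : Equiv.Perm (Fin n)) (p : ℕ) :
    #{i : Fin n | (π i : ℕ) < p ∧ p ≤ (i : ℕ)} = upArcs π p := by
  rw [← upArcs_inv, upArcs]
  refine card_bij (fun i _ => π i) (by simp) (by simp) fun j hj => ⟨π⁻¹ j, by simpa using hj⟩

theorem exists_down_of_up {π : Equiv.Perm (Fin n)} {p : ℕ} {i : Fin n} (h1 : (i : ℕ) < p)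
    (h2 : p ≤ (π i : ℕ)) : ∃ k : Fin n, p ≤ (k : ℕ) ∧ (π k : ℕ) < p := by
  have h : 0 < upArcs π⁻¹ p := by rw [upArcs_inv, upArcs_pos_iff]; exact ⟨i, h1, h2⟩
  obtain ⟨j, h3, h4⟩ := (upArcs_pos_iff _ _).1 h
  exact ⟨π⁻¹ j, h4, by simpa using h3⟩

/-- Excedances are matched to their values first in, first out. -/
def FirstInFirstOut (π : Equiv.Perm (Fin n)) : Prop :=
  ∀ i j, i < j → i < π i → j < π j → π i < π j

/-- Excedances are matched to their values last in, first out. -/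
def LastInFirstOut (π : Equiv.Perm (Fin n)) : Prop :=
  ∀ i j, i < j → j < π i → j < π j → π j < π i

theorem isNestedFixedPoint_iff {π : Equiv.Perm (Fin n)} {j : Fin n} :
    IsNestedFixedPoint π j ↔ π j = j ∧ 0 < upArcs π j := by
  refine and_congr_right fun hj => ?_
  constructor
  · rintro ⟨i, k, hi, hk, h | h⟩
    · exact (upArcs_pos_iff _ _).2 ⟨i, hi, by rw [h]; exact hk.le⟩
    · rw [← upArcs_inv]
      refine (upArcs_pos_iff _ _).2 ⟨i, hi, ?_⟩
      rw [← h, perm_inv_apply_self]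
      exact hk.le
  · intro h
    obtain ⟨i, h1, h2⟩ := (upArcs_pos_iff _ _).1 h
    refine ⟨i, π i, h1, lt_of_le_of_ne h2 fun h3 => ?_, Or.inl rfl⟩
    have := π.injective (hj.trans h3)
    omega

theorem avoids321_inv {π : Equiv.Perm (Fin n)} (h : Avoids321 π) : Avoids321 π⁻¹ := by
  rintro ⟨i, j, k, hij, hjk, h1, h2⟩
  exact h ⟨π⁻¹ k, π⁻¹ j, π⁻¹ i, h1, h2, by simpa, by simpa⟩

/-- If excedances `i < j` had their values reversed, the move of `j` over the gap after it would be
balanced by some later `k` with value at most `j`, and `i, j, k` would form a `321`. -/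
theorem Avoids321.firstInFirstOut {π : Equiv.Perm (Fin n)} (h : Avoids321 π) :
    FirstInFirstOut π := by
  intro i j hij hi hj
  by_contra hc
  have h1 : π j < π i := lt_of_le_of_ne (not_lt.1 hc) fun h2 => hij.ne' (π.injective h2)
  obtain ⟨k, hk, hk'⟩ := exists_down_of_up (π := π) (p := j + 1) (i := j) (by omega) (by omega)
  exact h ⟨i, j, k, hij, by omega, by omega, h1⟩

theorem Avoids321.not_nested {π : Equiv.Perm (Fin n)} (h : Avoids321 π) (j : Fin n) :
    ¬ IsNestedFixedPoint π j := by
  intro hn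
  obtain ⟨hj, hp⟩ := isNestedFixedPoint_iff.1 hn
  obtain ⟨i, h1, h2⟩ := (upArcs_pos_iff _ _).1 hp
  obtain ⟨k, h3, h4⟩ := exists_down_of_up h1 h2
  have h5 : π i ≠ π j := fun h => by have := π.injective h; omega
  have h6 : k ≠ j := fun h => by subst h; omega
  exact h ⟨i, j, k, h1, by omega, by omega, by omega⟩

theorem avoids321_iff {π : Equiv.Perm (Fin n)} :
    Avoids321 π ↔ FirstInFirstOut π ∧ FirstInFirstOut π⁻¹ ∧ ∀ j, ¬ IsNestedFixedPoint π j := by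
  refine ⟨fun h => ⟨h.firstInFirstOut, (avoids321_inv h).firstInFirstOut, h.not_nested⟩, ?_⟩
  rintro ⟨h1, h2, h3⟩ ⟨i, j, k, hij, hjk, h4, h5⟩
  -- The middle entry of a `321` decides the contradiction: it makes two lower arcs out of order, a
  -- nested fixed point, or two upper arcs out of order.
  rcases lt_trichotomy (π j) j with h | h | h
  · have := h2 (π k) (π j) h4 (by simpa using (h4.trans h).trans hjk) (by simpa using h)
    simp only [perm_inv_apply_self] at this
    omega
  · exact h3 j ⟨h, i, π i, hij, by rw [h] at h5; exact h5, Or.inl rfl⟩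
  · have := h1 i j hij (by omega) h
    omega

theorem word_eq_none_iff {π : Equiv.Perm (Fin n)} {i : Fin n} : word π i = none ↔ π i = i := by
  unfold word; split_ifs <;> simp_all

theorem word_eq_some_iff {π : Equiv.Perm (Fin n)} {i : Fin n} {p q : Bool} :
    word π i = some (p, q) ↔ π i ≠ i ∧ (p = true ↔ i < π i) ∧ (q = true ↔ π⁻¹ i < i) := by
  unfold word
  cases p <;> cases q <;> split_ifs <;> simp_all

theorem word_eq_word_iff {π σ : Equiv.Perm (Fin n)} {i : Fin n} :
    word π i = word σ i ↔ (i < π i ↔ i < σ i) ∧ (π i < i ↔ σ i < i) ∧ (π⁻¹ i < i ↔ σ⁻¹ i < i) := by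
  have h1 := inv_apply_eq_self_iff π i
  have h2 := inv_apply_eq_self_iff σ i
  unfold word
  split_ifs with h3 h4 h4
  · simp_all
  · simp_all; omega
  · simp_all; omega
  · simp; omega

theorem word_inv_eq_word_inv {π σ : Equiv.Perm (Fin n)} (h : word π = word σ) :
    word π⁻¹ = word σ⁻¹ := by
  funext i
  have h1 := word_eq_word_iff.1 (congrFun h i)
  have h2 := inv_apply_eq_self_iff π i
  have h3 := inv_apply_eq_self_iff σ i
  rw [word_eq_word_iff, inv_inv, inv_inv]
  omega

/-- Scanning from the left, if `π i < σ i` then `π i` is also an excedance value of `σ`, at some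
`k`. An earlier `k` is excluded by induction, a later one by the rule for `σ`. -/
theorem FirstInFirstOut.apply_eq {π σ : Equiv.Perm (Fin n)} (hπ : FirstInFirstOut π)
    (hσ : FirstInFirstOut σ) (h : word π = word σ) (i : Fin n) (hi : i < π i) : π i = σ i := by
  induction i using WellFoundedLT.induction with
  | _ i ih =>
  have key : ∀ {π σ : Equiv.Perm (Fin n)}, FirstInFirstOut σ → word π = word σ → i < π i →
      (∀ k < i, k < σ k → π k = σ k) → ¬ π i < σ i := by
    intro π σ hσ h hi ih hlt
    have h1 := (word_eq_word_iff.1 (congrFun h (π i))).2.2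
    have h2 := (word_eq_word_iff.1 (congrFun h i)).1
    simp only [perm_inv_apply_self] at h1
    obtain ⟨k, hk⟩ := σ.surjective (π i)
    have h3 : k < σ k := by rw [← hk] at h1; simp only [perm_inv_apply_self] at h1; omega
    rcases lt_trichotomy k i with h4 | h4 | h4
    · have := ih k h4 h3
      have := π.injective (this.trans hk)
      omega
    · subst h4; omega
    · have := hσ i k h4 (h2.1 hi) h3
      omega
  have h2 := (word_eq_word_iff.1 (congrFun h i)).1
  refine le_antisymm (not_lt.1 (key hπ h.symm (h2.1 hi) fun k hk hk' => (ih k hk hk').symm))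
    (not_lt.1 (key hσ h hi fun k hk hk' => ih k hk ?_))
  exact (word_eq_word_iff.1 (congrFun h k)).1.2 hk'

/-- The same argument scanning from the right: now later `k` fall to induction and earlier ones to
the rule. -/
theorem LastInFirstOut.apply_eq {π σ : Equiv.Perm (Fin n)} (hπ : LastInFirstOut π)
    (hσ : LastInFirstOut σ) (h : word π = word σ) (i : Fin n) (hi : i < π i) : π i = σ i := by
  induction i using WellFoundedGT.induction with
  | _ i ih =>
  have key : ∀ {π σ : Equiv.Perm (Fin n)}, LastInFirstOut σ → word π = word σ → i < π i →
      (∀ k > i, k < σ k → π k = σ k) → ¬ π i < σ i := by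
    intro π σ hσ h hi ih hlt
    have h1 := (word_eq_word_iff.1 (congrFun h (π i))).2.2
    have h2 := (word_eq_word_iff.1 (congrFun h i)).1
    simp only [perm_inv_apply_self] at h1
    obtain ⟨k, hk⟩ := σ.surjective (π i)
    have h3 : k < σ k := by rw [← hk] at h1; simp only [perm_inv_apply_self] at h1; omega
    rcases lt_trichotomy k i with h4 | h4 | h4
    · have := hσ k i h4 (by omega) (h2.1 hi)
      omega
    · subst h4; omega
    · have := ih k h4 h3
      have := π.injective (this.trans hk)
      omega
  have h2 := (word_eq_word_iff.1 (congrFun h i)).1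
  refine le_antisymm (not_lt.1 (key hπ h.symm (h2.1 hi) fun k hk hk' => (ih k hk hk').symm))
    (not_lt.1 (key hσ h hi fun k hk hk' => ih k hk ?_))
  exact (word_eq_word_iff.1 (congrFun h k)).1.2 hk'

/-- A permutation is determined by its word, its excedances and the excedances of its inverse. -/
theorem eq_of_word_eq {π σ : Equiv.Perm (Fin n)} (h : word π = word σ)
    (h1 : ∀ i, i < π i → π i = σ i) (h2 : ∀ i, i < π⁻¹ i → π⁻¹ i = σ⁻¹ i) : π = σ := by
  ext1 i
  rcases lt_trichotomy i (π i) with hi | hi | hi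
  · exact h1 i hi
  · have := word_eq_word_iff.1 (congrFun h i)
    omega
  · have := h2 (π i) (by simpa using hi)
    rw [perm_inv_apply_self, eq_comm, Equiv.Perm.inv_eq_iff_eq] at this
    exact this

/-- Exchanging the values of two excedances does not change the word. -/
theorem word_mul_swap {π : Equiv.Perm (Fin n)} {i j : Fin n} (hij : i < j) (hi : j < π i)
    (hj : j < π j) : word (π * Equiv.swap i j) = word π := by
  funext k
  rw [word_eq_word_iff]
  have h1 : (π * Equiv.swap i j) k = if k = i then π j else if k = j then π i else π k := by
    rw [Equiv.Perm.mul_apply, Equiv.swap_apply_def]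
    split_ifs <;> rfl
  have h2 : (π * Equiv.swap i j)⁻¹ k =
      if π⁻¹ k = i then j else if π⁻¹ k = j then i else π⁻¹ k := by
    rw [mul_inv_rev, Equiv.swap_inv, Equiv.Perm.mul_apply, Equiv.swap_apply_def]
  have h3 : π⁻¹ k = i → k = π i := fun h => by rw [← h]; simp
  have h4 : π⁻¹ k = j → k = π j := fun h => by rw [← h]; simp
  rw [h1, h2]
  refine ⟨?_, ?_, ?_⟩
  · split_ifs <;> subst_vars <;> omega
  · split_ifs <;> subst_vars <;> omega
  · split_ifs <;> grind

theorem sum_mul_swap_lt {π : Equiv.Perm (Fin n)} {i j : Fin n} (hij : i < j) (h : π i < π j) :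
    ∑ k : Fin n, (k : ℕ) * ((π * Equiv.swap i j) k : ℕ) < ∑ k : Fin n, (k : ℕ) * (π k : ℕ) := by
  have hj : j ∈ univ.erase i := by simp [hij.ne']
  rw [← add_sum_erase _ _ (mem_univ i), ← add_sum_erase _ _ hj,
    ← add_sum_erase _ _ (mem_univ i), ← add_sum_erase _ _ hj]
  have : ∑ k ∈ (univ.erase i).erase j, (k : ℕ) * ((π * Equiv.swap i j) k : ℕ) =
      ∑ k ∈ (univ.erase i).erase j, (k : ℕ) * (π k : ℕ) := by
    refine sum_congr rfl fun k hk => ?_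
    simp only [mem_erase, mem_univ, and_true] at hk
    rw [Equiv.Perm.mul_apply, Equiv.swap_apply_of_ne_of_ne hk.2 hk.1]
  rw [this, ← add_assoc, ← add_assoc]
  refine Nat.add_lt_add_right ?_ _
  simp only [Equiv.Perm.mul_apply, Equiv.swap_apply_left, Equiv.swap_apply_right]
  rw [Fin.lt_def] at hij h
  nlinarith

theorem sum_mul_inv_apply (π : Equiv.Perm (Fin n)) :
    ∑ k : Fin n, (k : ℕ) * (π⁻¹ k : ℕ) = ∑ k : Fin n, (k : ℕ) * (π k : ℕ) := by
  rw [← Equiv.sum_comp π fun k : Fin n => (k : ℕ) * (π⁻¹ k : ℕ)]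
  refine sum_congr rfl fun k _ => ?_
  rw [perm_inv_apply_self, mul_comm]

/-- Take a minimiser of `∑ k * π k` among the permutations with this word. A crossing of two arcs
could be undone by a swap that keeps the word and lowers the sum. The sum is the same for `π` and
`π⁻¹`, so one minimiser serves both sides. -/
theorem exists_lastInFirstOut (σ : Equiv.Perm (Fin n)) :
    ∃ π : Equiv.Perm (Fin n), word π = word σ ∧ LastInFirstOut π ∧ LastInFirstOut π⁻¹ := by
  classical
  obtain ⟨π, hπ, hmin⟩ := exists_min_image (univ.filter fun π => word π = word σ)
    (fun π : Equiv.Perm (Fin n) => ∑ k : Fin n, (k : ℕ) * (π k : ℕ)) ⟨σ, by simp⟩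
  simp only [mem_filter, mem_univ, true_and] at hπ hmin
  refine ⟨π, hπ, fun i j hij hi hj => ?_, fun i j hij hi hj => ?_⟩
  · by_contra hc
    have hc' : π i < π j := lt_of_le_of_ne (not_lt.1 hc) fun h => hij.ne (π.injective h)
    exact (hmin _ ((word_mul_swap hij hi hj).trans hπ)).not_gt (sum_mul_swap_lt hij hc')
  · by_contra hc
    have hc' : π⁻¹ i < π⁻¹ j := lt_of_le_of_ne (not_lt.1 hc) fun h => hij.ne (π⁻¹.injective h)
    have h1 := word_inv_eq_word_inv (word_mul_swap hij hi hj)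
    rw [inv_inv] at h1
    have h2 := sum_mul_swap_lt hij hc'
    rw [sum_mul_inv_apply, ← sum_mul_inv_apply (π⁻¹ * Equiv.swap i j)] at h2
    exact (hmin _ (h1.trans hπ)).not_gt h2

end Words

/-! ### Unimodal noncrossing cycles as last-in-first-out matchings -/

section Cycles

variable {n : ℕ}

theorem exists_pow_eq_of_sameCycle {π : Equiv.Perm (Fin n)} {a i : Fin n}
    (h : π.SameCycle a i) : ∃ s < Function.minimalPeriod π a, (π ^ s) a = i := by
  obtain ⟨s, hs⟩ := h.exists_nat_pow_eq
  have hpos : 0 < Function.minimalPeriod π a := Function.minimalPeriod_pos_of_mem_periodicPts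
    (π.injective.mem_periodicPts a)
  refine ⟨s % Function.minimalPeriod π a, Nat.mod_lt _ hpos, ?_⟩
  rw [← Equiv.Perm.iterate_eq_pow, Function.iterate_mod_minimalPeriod_eq,
    Equiv.Perm.iterate_eq_pow, hs]

theorem pow_minimalPeriod_apply (π : Equiv.Perm (Fin n)) (a : Fin n) :
    (π ^ Function.minimalPeriod π a) a = a := by
  rw [← Equiv.Perm.iterate_eq_pow]
  exact Function.iterate_minimalPeriod

theorem perm_pow_succ_apply (π : Equiv.Perm (Fin n)) (s : ℕ) (a : Fin n) :
    (π ^ (s + 1)) a = π ((π ^ s) a) := by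
  rw [pow_succ', Equiv.Perm.mul_apply]

theorem exists_cycle_min (π : Equiv.Perm (Fin n)) (i : Fin n) :
    ∃ a, π.SameCycle a i ∧ ∀ b, π.SameCycle a b → a ≤ b := by
  classical
  obtain ⟨a, ha, hmin⟩ := exists_min_image (univ.filter fun a => π.SameCycle a i) id
    ⟨i, by simp [Equiv.Perm.SameCycle.refl]⟩
  simp only [mem_filter, mem_univ, true_and] at ha hmin
  exact ⟨a, ha, fun b hb => hmin b (hb.symm.trans ha)⟩

/-- The point `i` is a strict local minimum of its cycle. -/
def IsValley (π : Equiv.Perm (Fin n)) (i : Fin n) : Prop := i < π i ∧ i < π⁻¹ i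

/-- Every cycle has at most one strict local minimum. -/
def UniqueValleys (π : Equiv.Perm (Fin n)) : Prop :=
  ∀ i j, π.SameCycle i j → IsValley π i → IsValley π j → i = j

theorem UniqueValleys.inv {π : Equiv.Perm (Fin n)} (h : UniqueValleys π) :
    UniqueValleys π⁻¹ := fun i j hij hi hj =>
  h i j (Equiv.Perm.sameCycle_inv.1 hij) ⟨by simpa using hi.2, hi.1⟩ ⟨by simpa using hj.2, hj.1⟩

theorem isValley_of_min {π : Equiv.Perm (Fin n)} {a : Fin n}
    (hmin : ∀ b, π.SameCycle a b → a ≤ b) (ha : π a ≠ a) : IsValley π a := by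
  refine ⟨lt_of_le_of_ne (hmin _ ⟨1, by simp⟩) ha.symm,
    lt_of_le_of_ne (hmin _ ⟨-1, by simp⟩) fun h => ha ?_⟩
  rw [← inv_apply_eq_self_iff, ← h]

/-- In a unimodal cycle the ascents precede the turning point. -/
theorem UnimodalFrom.exists_ascents {π : Equiv.Perm (Fin n)} {a : Fin n}
    (h : UnimodalFrom π a) (hmin : ∀ b, π.SameCycle a b → a ≤ b) :
    ∃ m, (∀ s, s < m → (π ^ s) a < (π ^ (s + 1)) a) ∧
      ∀ s < Function.minimalPeriod π a, (π ^ s) a < (π ^ (s + 1)) a → s < m := by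
  obtain ⟨m, hm, h1, h2⟩ := h
  refine ⟨m, h1, fun s hs hlt => ?_⟩
  by_contra hc
  rcases Nat.lt_or_ge (s + 1) (Function.minimalPeriod π a) with h3 | h3
  · exact (h2 s (by omega) h3).not_gt hlt
  · have h4 : s + 1 = Function.minimalPeriod π a := by omega
    rw [h4, pow_minimalPeriod_apply] at hlt
    exact (hmin _ ⟨s, by simp⟩).not_gt hlt

/-- A valley is left by an ascent. Ascents form an initial run, so a valley other than the starting
point would also be entered by an ascent. -/
theorem UnimodalFrom.eq_of_isValley {π : Equiv.Perm (Fin n)} {a i : Fin n}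
    (h : UnimodalFrom π a) (hmin : ∀ b, π.SameCycle a b → a ≤ b) (hi : π.SameCycle a i)
    (hv : IsValley π i) : i = a := by
  obtain ⟨m, h1, h2⟩ := h.exists_ascents hmin
  obtain ⟨s, hs, rfl⟩ := exists_pow_eq_of_sameCycle hi
  have h3 := h2 s hs (by rw [perm_pow_succ_apply]; exact hv.1)
  cases s with
  | zero => simp
  | succ s =>
    have h4 := h1 s (by omega)
    have h5 := hv.2
    nth_rw 2 [perm_pow_succ_apply] at h5
    rw [perm_inv_apply_self] at h5
    exact absurd h4 h5.not_gt

/-- Replaces unimodality by a local condition that is visibly stable under inversion. -/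
theorem unimodalCycles_iff {π : Equiv.Perm (Fin n)} : UnimodalCycles π ↔ UniqueValleys π := by
  constructor
  · intro h i j hij hi hj
    obtain ⟨a, ha, hmin⟩ := exists_cycle_min π i
    rw [(h a hmin).eq_of_isValley hmin ha hi, (h a hmin).eq_of_isValley hmin (ha.trans hij) hj]
  · intro h a hmin
    have hpos : 0 < Function.minimalPeriod π a := Function.minimalPeriod_pos_of_mem_periodicPts
      (π.injective.mem_periodicPts a)
    -- The turning point is the first non-ascent; it exists because the last step returns to the
    -- minimum.
    have hex : ∃ s, (π ^ (s + 1)) a ≤ (π ^ s) a := by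
      refine ⟨Function.minimalPeriod π a - 1, ?_⟩
      rw [Nat.sub_add_cancel hpos, pow_minimalPeriod_apply]
      exact hmin _ ⟨_, by rw [zpow_natCast]⟩
    classical
    have hm : Nat.find hex < Function.minimalPeriod π a := by
      refine lt_of_le_of_lt (Nat.find_min' hex (m := Function.minimalPeriod π a - 1) ?_) (by omega)
      rw [Nat.sub_add_cancel hpos, pow_minimalPeriod_apply]
      exact hmin _ ⟨_, by rw [zpow_natCast]⟩
    have hne : ∀ s, s + 1 < Function.minimalPeriod π a → (π ^ (s + 1)) a ≠ (π ^ s) a := by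
      intro s hs he
      rw [← Equiv.Perm.iterate_eq_pow, ← Equiv.Perm.iterate_eq_pow,
        Function.iterate_eq_iterate_iff_of_lt_minimalPeriod hs (by omega)] at he
      omega
    refine ⟨Nat.find hex, hm, fun s hs => not_le.1 (Nat.find_min hex hs), fun s hs => ?_⟩
    induction s, hs using Nat.le_induction with
    | base => exact fun hs => lt_of_le_of_ne (Nat.find_spec hex) (hne _ hs)
    | succ s hs ih =>
      intro hs'
      refine lt_of_le_of_ne (not_lt.1 fun hc => ?_) (hne _ hs')
      -- An ascent after a descent would create a second valley besides the minimum `a`.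
      have hv : IsValley π ((π ^ (s + 1)) a) := by
        refine ⟨by rw [← perm_pow_succ_apply]; exact hc, ?_⟩
        nth_rw 2 [perm_pow_succ_apply]
        rw [perm_inv_apply_self]
        exact ih (by omega)
      have hcyc : π.SameCycle a ((π ^ (s + 1)) a) := ⟨_, by rw [zpow_natCast]⟩
      have ha : π a ≠ a := fun ha => by
        have := Equiv.Perm.SameCycle.eq_of_left hcyc ha
        rw [← this] at hv
        have := hv.1
        rw [ha] at this
        exact this.false
      have h1 := h a _ hcyc (isValley_of_min hmin ha) hv
      have h2 : (π ^ 0) a = (π ^ (s + 1)) a := by rw [← h1]; simp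
      rw [← Equiv.Perm.iterate_eq_pow, ← Equiv.Perm.iterate_eq_pow,
        Function.iterate_eq_iterate_iff_of_lt_minimalPeriod hpos (by omega)] at h2
      omega

theorem NoncrossingCycles.inv {π : Equiv.Perm (Fin n)} (h : NoncrossingCycles π) :
    NoncrossingCycles π⁻¹ := by
  simpa only [NoncrossingCycles, Equiv.Perm.sameCycle_inv] using h

/-- Two crossing upper arcs must lie in one cycle. There the ascents form a single increasing chain,
so distinct arcs cannot overlap. -/
theorem NoncrossingCycles.lastInFirstOut {π : Equiv.Perm (Fin n)} (h : NoncrossingCycles π)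
    (hu : UnimodalCycles π) : LastInFirstOut π := by
  intro i j hij hi hj
  by_contra hc
  have hlt : π i < π j := lt_of_le_of_ne (not_lt.1 hc) fun h => hij.ne (π.injective h)
  have hsame : π.SameCycle i j := by
    by_contra hn
    exact h ⟨i, j, π i, π j, hij, hi, hlt, ⟨1, by simp⟩, ⟨1, by simp⟩, hn⟩
  obtain ⟨a, ha, hmin⟩ := exists_cycle_min π i
  obtain ⟨m, h1, h2⟩ := (hu a hmin).exists_ascents hmin
  obtain ⟨s, hs, rfl⟩ := exists_pow_eq_of_sameCycle ha
  obtain ⟨r, hr, rfl⟩ := exists_pow_eq_of_sameCycle (ha.trans hsame)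
  rw [← perm_pow_succ_apply] at hi hj
  have h3 := h2 s hs (hij.trans hi)
  have h4 := h2 r hr hj
  have hmono : ∀ s t, s ≤ t → t ≤ m → (π ^ s) a ≤ (π ^ t) a := by
    intro s t hst
    induction t, hst using Nat.le_induction with
    | base => exact fun _ => le_rfl
    | succ t hst ih => exact fun ht => (ih (by omega)).trans (h1 t (by omega)).le
  rcases lt_trichotomy s r with h5 | h5 | h5
  · exact (hmono (s + 1) r h5 h4.le).not_gt hi
  · subst h5; exact hij.false
  · exact (hmono r s h5.le h3.le).not_gt hij

theorem wordHeight_succ (w : Fin n → Letter) (i : Fin n) :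
    wordHeight w (i + 1) = wordHeight w i + (w i).rise := by
  have h : (w i).rise = ∑ j : Fin n, if j = i then (w j).rise else 0 := by simp
  rw [h, wordHeight, wordHeight, ← sum_add_distrib]
  refine sum_congr rfl fun j _ => ?_
  split_ifs <;> omega

theorem upArcs_succ (π : Equiv.Perm (Fin n)) (i : Fin n) :
    (upArcs π (i + 1) : ℤ) =
      upArcs π i + ((if i < π i then 1 else 0) - (if π⁻¹ i < i then 1 else 0)) := by
  rw [← wordHeight_word, ← wordHeight_word, wordHeight_succ, rise_word]

/-- The height at `i`: the larger of the heights of the two adjacent gaps. -/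
def level (π : Equiv.Perm (Fin n)) (i : Fin n) : ℕ := max (upArcs π i) (upArcs π (i + 1))

/-- Two points are linked if they are at the same level and the height does not drop below that
level between them. -/
def Linked (π : Equiv.Perm (Fin n)) (i j : Fin n) : Prop :=
  level π i = level π j ∧
    ∀ p : ℕ, (i < p ∧ p ≤ j) ∨ ((j : ℕ) < p ∧ p ≤ i) → level π i ≤ upArcs π p

theorem Linked.refl (π : Equiv.Perm (Fin n)) (i : Fin n) : Linked π i i :=
  ⟨rfl, fun p hp => by omega⟩

theorem Linked.symm {π : Equiv.Perm (Fin n)} {i j : Fin n} (h : Linked π i j) : Linked π j i :=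
  ⟨h.1.symm, fun p hp => h.1 ▸ h.2 p hp.symm⟩

theorem Linked.trans {π : Equiv.Perm (Fin n)} {i j k : Fin n} (h : Linked π i j)
    (h' : Linked π j k) : Linked π i k := by
  refine ⟨h.1.trans h'.1, fun p hp => ?_⟩
  by_cases hp' : (i < p ∧ p ≤ j) ∨ ((j : ℕ) < p ∧ p ≤ i)
  · exact h.2 p hp'
  · rw [h.1]; exact h'.2 p (by omega)

theorem linked_inv {π : Equiv.Perm (Fin n)} {i j : Fin n} :
    Linked π⁻¹ i j ↔ Linked π i j := by
  simp only [Linked, level, upArcs_inv]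

/-- Nesting makes every arc over the gap after `i` stay open until `π i`, and every arc over the gap
before `π i` start no later than `i`. -/
theorem LastInFirstOut.linked {π : Equiv.Perm (Fin n)} (h : LastInFirstOut π) {i : Fin n}
    (hi : i < π i) : Linked π i (π i) := by
  have h1 := upArcs_succ π i
  have h2 := upArcs_succ π (π i)
  rw [perm_inv_apply_self, if_pos hi] at h2
  rw [if_pos hi] at h1
  have h3 : level π i = upArcs π (i + 1) := by
    rw [level, max_eq_right]; split_ifs at h1 <;> omega
  have h4 : level π (π i) = upArcs π (π i) := by
    rw [level, max_eq_left]; split_ifs at h2 <;> omega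
  have h5 : ∀ p : ℕ, i < p → p ≤ π i → upArcs π (i + 1) ≤ upArcs π p := by
    intro p hp hp'
    refine card_le_card fun k hk => ?_
    simp only [mem_filter, mem_univ, true_and] at hk ⊢
    rcases lt_or_eq_of_le (show k ≤ i by omega) with h6 | h6
    · have := h k i h6 (by omega) hi
      omega
    · subst h6; omega
  have h6 : upArcs π (π i) ≤ upArcs π (i + 1) := by
    refine card_le_card fun k hk => ?_
    simp only [mem_filter, mem_univ, true_and] at hk ⊢
    have : ¬ i < k := fun hik => by
      have := h i k hik (by omega) (by omega)
      omega
    omega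
  refine ⟨?_, fun p hp => ?_⟩
  · rw [h3, h4]; exact le_antisymm (h5 _ hi le_rfl) h6
  · rw [h3]; exact h5 p (by omega) (by omega)

theorem linked_of_sameCycle {π : Equiv.Perm (Fin n)} (h : LastInFirstOut π)
    (h' : LastInFirstOut π⁻¹) {i j : Fin n} (hij : π.SameCycle i j) : Linked π i j := by
  have hstep : ∀ k, Linked π k (π k) := by
    intro k
    rcases lt_trichotomy k (π k) with hk | hk | hk
    · exact h.linked hk
    · rw [← hk]; exact .refl π k
    · have := h'.linked (i := π k) (by rwa [perm_inv_apply_self])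
      rw [perm_inv_apply_self, linked_inv] at this
      exact this.symm
  obtain ⟨s, rfl⟩ := hij.exists_nat_pow_eq
  induction s with
  | zero => exact .refl π i
  | succ s ih =>
    rw [perm_pow_succ_apply]
    exact (ih ⟨s, by rw [zpow_natCast]⟩).trans (hstep _)

/-- Just before a valley the height is one below its level, which blocks any link to the left. -/
theorem Linked.eq_of_isValley {π : Equiv.Perm (Fin n)} {i j : Fin n} (h : Linked π i j)
    (hi : IsValley π i) (hj : IsValley π j) : i = j := by
  have key : ∀ {i j : Fin n}, Linked π i j → IsValley π j → ¬ i < j := by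
    intro i j h hj hlt
    have h1 := upArcs_succ π j
    rw [if_pos hj.1, if_neg hj.2.not_gt] at h1
    have h2 := h.2 j (Or.inl ⟨hlt, le_rfl⟩)
    rw [h.1, level] at h2
    omega
  exact le_antisymm (not_lt.1 (key h.symm hi)) (not_lt.1 (key h hj))

/-- The minimum of each nontrivial cycle is a valley, and linked valleys coincide. -/
theorem Linked.sameCycle {π : Equiv.Perm (Fin n)} (h : LastInFirstOut π)
    (h' : LastInFirstOut π⁻¹) {i j : Fin n} (hij : Linked π i j) (hi : π i ≠ i) (hj : π j ≠ j) :
    π.SameCycle i j := by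
  have key : ∀ i, π i ≠ i → ∃ a, π.SameCycle a i ∧ IsValley π a := by
    intro i hi
    obtain ⟨a, ha, hmin⟩ := exists_cycle_min π i
    exact ⟨a, ha, isValley_of_min hmin fun hfix => hi (by rw [← ha.eq_of_left hfix, hfix])⟩
  obtain ⟨a, ha, hva⟩ := key i hi
  obtain ⟨b, hb, hvb⟩ := key j hj
  have hab := ((linked_of_sameCycle h h' ha).trans hij).trans (linked_of_sameCycle h h' hb).symm
  rw [hab.eq_of_isValley hva hvb] at ha
  exact ha.symm.trans hb

theorem LastInFirstOut.noncrossingCycles {π : Equiv.Perm (Fin n)} (h : LastInFirstOut π)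
    (h' : LastInFirstOut π⁻¹) : NoncrossingCycles π := by
  rintro ⟨i, j, k, l, hij, hjk, hkl, hik, hjl, hn⟩
  have h1 := linked_of_sameCycle h h' hik
  have h2 := linked_of_sameCycle h h' hjl
  have hi : π i ≠ i := fun hf => by have := hik.eq_of_left hf; omega
  have hj : π j ≠ j := fun hf => by have := hjl.eq_of_left hf; omega
  refine hn (Linked.sameCycle h h' ⟨?_, fun p hp => h1.2 p (by omega)⟩ hi hj)
  -- The gaps before `j` and `k` give `level i ≤ level j ≤ level k = level i`, so `i` and `j` are
  -- linked.
  have h3 := h1.2 j (by omega)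
  have h4 := h2.2 k (by omega)
  have h5 : upArcs π j ≤ level π j := le_max_left _ _
  have h6 : upArcs π k ≤ level π k := le_max_left _ _
  have h7 := h1.1
  omega

theorem mem_unimodalNoncrossing_iff {π : Equiv.Perm (Fin n)} :
    π ∈ unimodalNoncrossing n ↔
      LastInFirstOut π ∧ LastInFirstOut π⁻¹ ∧ ∀ j, ¬ IsNestedFixedPoint π j := by
  classical
  rw [unimodalNoncrossing, mem_filter, and_iff_right (mem_univ _)]
  constructor
  · rintro ⟨h1, h2, h3⟩
    exact ⟨h2.lastInFirstOut h1, h2.inv.lastInFirstOut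
      (unimodalCycles_iff.2 (unimodalCycles_iff.1 h1).inv), h3⟩
  · rintro ⟨h1, h2, h3⟩
    refine ⟨unimodalCycles_iff.2 fun i j hij hi hj => ?_, h1.noncrossingCycles h2, h3⟩
    exact (linked_of_sameCycle h1 h2 hij).eq_of_isValley hi hj

theorem mem_avoiding321_iff {π : Equiv.Perm (Fin n)} :
    π ∈ avoiding321 n ↔
      FirstInFirstOut π ∧ FirstInFirstOut π⁻¹ ∧ ∀ j, ¬ IsNestedFixedPoint π j := by
  classical
  rw [avoiding321, mem_filter, and_iff_right (mem_univ _), avoids321_iff]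

end Cycles

/-! ### Valid words and the bijections with both classes -/

section ValidWords

variable {n : ℕ}

/-- The letter is allowed at the given height. -/
def Letter.Fits (h : ℤ) : Letter → Prop
  | none => h = 0
  | some (true, false) => True
  | some _ => 1 ≤ h

/-- Words that describe a labelled Motzkin path: they end at height zero, and every letter is
allowed at its height. -/
def ValidWord (w : Fin n → Letter) : Prop :=
  (∀ i : Fin n, (w i).Fits (wordHeight w i)) ∧ wordHeight w n = 0

theorem fits_word_some {π : Equiv.Perm (Fin n)} {i : Fin n} (hi : π i ≠ i) :
    (word π i).Fits (wordHeight (word π) i) := by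
  have h1 : π i < i → 0 < upArcs π i := fun h => by
    rw [← upArcs_inv, upArcs_pos_iff]
    exact ⟨π i, h, by rw [perm_inv_apply_self]⟩
  have h2 : π⁻¹ i < i → 0 < upArcs π i := fun h => by
    rw [upArcs_pos_iff]
    exact ⟨π⁻¹ i, h, by rw [perm_apply_inv_self]⟩
  rw [wordHeight_word]
  rcases hw : word π i with _ | ⟨p, q⟩
  · exact absurd (word_eq_none_iff.1 hw) hi
  · obtain ⟨-, hp, hq⟩ := word_eq_some_iff.1 hw
    cases p <;> cases q <;> simp only [Letter.Fits, Bool.false_eq_true, false_iff, true_iff] at * <;>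
      omega

theorem validWord_word_iff {π : Equiv.Perm (Fin n)} :
    ValidWord (word π) ↔ ∀ j, ¬ IsNestedFixedPoint π j := by
  constructor
  · rintro ⟨h, -⟩ j hj
    obtain ⟨h1, h2⟩ := isNestedFixedPoint_iff.1 hj
    have h3 := h j
    rw [word_eq_none_iff.2 h1, wordHeight_word] at h3
    simp only [Letter.Fits] at h3
    omega
  · intro h
    refine ⟨fun i => ?_, ?_⟩
    · by_cases hi : π i = i
      · have h1 := h i
        rw [isNestedFixedPoint_iff] at h1
        rw [word_eq_none_iff.2 hi, wordHeight_word]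
        simp only [Letter.Fits]
        have : ¬ 0 < upArcs π i := fun h2 => h1 ⟨hi, h2⟩
        omega
      · exact fits_word_some hi
    · rw [wordHeight_word, Nat.cast_eq_zero, upArcs, card_eq_zero, filter_eq_empty_iff]
      intro i _
      omega

/-- The increasing bijection between two sets of points moves every point up if the second set
never gets ahead of the first. -/
theorem exists_orderIso_lt {A B : Finset (Fin n)} (hc : #A = #B)
    (hb : ∀ j ∈ B, #{b ∈ B | b < j} < #{a ∈ A | a < j}) :
    ∃ e : A ≃o B, ∀ a : A, (a : Fin n) < e a := by
  refine ⟨(A.orderIsoOfFin rfl).symm.trans (B.orderIsoOfFin hc.symm), fun a => ?_⟩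
  set e : A ≃o B := (A.orderIsoOfFin rfl).symm.trans (B.orderIsoOfFin hc.symm)
  by_contra h
  rw [not_lt] at h
  -- If `e a ≤ a`, the points of `A` below `a` are as many as those of `B` below `e a`, hence fewer
  -- than those of `A` below `e a`, which is absurd.
  have h1 : #{x ∈ A | x < (a : Fin n)} = #{b ∈ B | b < (e a : Fin n)} := by
    refine card_bij (fun x hx => e ⟨x, (mem_filter.1 hx).1⟩) (fun x hx => ?_)
      (fun x hx y hy hxy => ?_) fun b hb => ?_
    · refine mem_filter.2 ⟨(e _).2, ?_⟩
      exact e.lt_iff_lt.2 (mem_filter.1 hx).2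
    · simpa using hxy
    · obtain ⟨hb, hlt⟩ := mem_filter.1 hb
      refine ⟨e.symm ⟨b, hb⟩, mem_filter.2 ⟨(e.symm _).2, ?_⟩, by simp⟩
      exact e.symm_apply_lt.2 hlt
  have h2 := hb (e a) (e a).2
  have h3 : #{x ∈ A | x < (e a : Fin n)} ≤ #{x ∈ A | x < (a : Fin n)} :=
    card_le_card (monotone_filter_right A fun x _ hx => lt_of_lt_of_le hx h)
  omega

/-- The positions of a word whose letters satisfy `f`. -/
def positions (w : Fin n → Letter) (f : Bool × Bool → Bool) : Finset (Fin n) :=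
  {i | (w i).any f = true}

theorem wordHeight_eq_sub (w : Fin n → Letter) (f g : Bool × Bool → Bool)
    (hfg : ∀ s, Letter.rise (some s) = (if f s then 1 else 0) - (if g s then 1 else 0)) (p : ℕ) :
    wordHeight w p =
      #{i ∈ positions w f | Fin.val i < p} - ((#{i ∈ positions w g | Fin.val i < p} : ℕ) : ℤ) := by
  rw [positions, positions, filter_filter, filter_filter, card_filter, card_filter, Nat.cast_sum,
    Nat.cast_sum, ← sum_sub_distrib, wordHeight]
  refine sum_congr rfl fun i _ => ?_
  rcases hw : w i with _ | s
  · simp [Letter.rise]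
  · rw [hfg]
    by_cases h : (i : ℕ) < p <;> simp [h]

/-- The tests `f`, `g` select arc starts and arc ends, for upper or for lower arcs. By `hg`, no arc
end carries the one letter allowed at every height, so an arc is always open there. -/
theorem ValidWord.exists_orderIso {w : Fin n → Letter} (hw : ValidWord w)
    (f g : Bool × Bool → Bool)
    (hfg : ∀ s, Letter.rise (some s) = (if f s then 1 else 0) - (if g s then 1 else 0))
    (hg : g (true, false) = false) :
    ∃ e : positions w f ≃o positions w g, ∀ a : positions w f, (a : Fin n) < e a := by
  refine exists_orderIso_lt ?_ fun j hj => ?_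
  · have h := hw.2
    rw [wordHeight_eq_sub w f g hfg] at h
    simp only [Fin.is_lt, filter_true] at h
    omega
  · have h := wordHeight_eq_sub w f g hfg j
    have h1 := hw.1 j
    simp only [Fin.lt_def]
    have h2 : 1 ≤ wordHeight w j := by
      simp only [positions, mem_filter, mem_univ, true_and] at hj
      rcases hs : w j with _ | ⟨p, q⟩
      · simp [hs] at hj
      · rw [hs] at h1 hj
        cases p <;> cases q <;> simp_all [Letter.Fits]
    omega

theorem ValidWord.exists_firstInFirstOut {w : Fin n → Letter} (hw : ValidWord w) :
    ∃ π : Equiv.Perm (Fin n), word π = w ∧ FirstInFirstOut π ∧ FirstInFirstOut π⁻¹ := by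
  obtain ⟨e, he⟩ := hw.exists_orderIso (fun s => s.1) (fun s => s.2)
    (by rintro ⟨p, q⟩; rfl) rfl
  obtain ⟨e', he'⟩ := hw.exists_orderIso (fun s => !s.2) (fun s => !s.1)
    (by rintro ⟨p, q⟩; cases p <;> cases q <;> rfl) rfl
  have hmem : ∀ i f, i ∈ positions w f ↔ ∃ p q, w i = some (p, q) ∧ f (p, q) = true := by
    intro i f
    simp only [positions, mem_filter, mem_univ, true_and]
    rcases w i with _ | s
    · simp
    · exact ⟨fun h => ⟨s.1, s.2, rfl, h⟩, by rintro ⟨p, q, h, h'⟩; cases h; exact h'⟩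
  -- `F` follows `e` along upper arcs and runs `e'` backwards along lower arcs, which go from right
  -- to left.
  obtain ⟨F, hF1, hF2, hF3⟩ : ∃ F : Fin n → Fin n,
      (∀ i hi, F i = e ⟨i, hi⟩) ∧ (∀ i hi, F i = e'.symm ⟨i, hi⟩) ∧
      ∀ i, w i = none → F i = i := by
    refine ⟨fun i => if hi : i ∈ positions w (fun s => s.1) then e ⟨i, hi⟩ else
      if hi' : i ∈ positions w (fun s => !s.1) then e'.symm ⟨i, hi'⟩ else i,
      fun i hi => dif_pos hi, fun i hi => ?_, fun i hi => ?_⟩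
    · dsimp only
      rw [dif_neg, dif_pos hi]
      rw [hmem] at hi ⊢
      rintro ⟨p, q, h1, h2⟩
      obtain ⟨p', q', h3, h4⟩ := hi
      rw [h1] at h3
      simp_all
    · dsimp only
      rw [dif_neg, dif_neg] <;> rw [hmem] <;> rintro ⟨p, q, h1, -⟩ <;> simp_all
  have h1 : ∀ i q, w i = some (true, q) → i < F i ∧ ∃ p, w (F i) = some (p, true) := by
    intro i q hi
    have hi' : i ∈ positions w (fun s => s.1) := (hmem _ _).2 ⟨_, _, hi, rfl⟩
    rw [hF1 i hi']
    refine ⟨he ⟨i, hi'⟩, ?_⟩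
    obtain ⟨p, q, h1, h2⟩ := (hmem _ _).1 (e ⟨i, hi'⟩).2
    exact ⟨p, by rw [h1]; simpa using h2⟩
  have h2 : ∀ i q, w i = some (false, q) → F i < i ∧ ∃ p, w (F i) = some (p, false) := by
    intro i q hi
    have hi' : i ∈ positions w (fun s => !s.1) := (hmem _ _).2 ⟨_, _, hi, rfl⟩
    rw [hF2 i hi']
    refine ⟨by simpa using he' (e'.symm ⟨i, hi'⟩), ?_⟩
    obtain ⟨p, q, h1, h2⟩ := (hmem _ _).1 (e'.symm ⟨i, hi'⟩).2
    exact ⟨p, by rw [h1]; simpa using h2⟩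
  have hm1 : ∀ i j q q', w i = some (true, q) → w j = some (true, q') → i < j → F i < F j := by
    intro i j q q' hi hj hij
    rw [hF1 i ((hmem _ _).2 ⟨_, _, hi, rfl⟩), hF1 j ((hmem _ _).2 ⟨_, _, hj, rfl⟩)]
    exact e.lt_iff_lt.2 hij
  have hm2 : ∀ i j q q', w i = some (false, q) → w j = some (false, q') → i < j → F i < F j := by
    intro i j q q' hi hj hij
    rw [hF2 i ((hmem _ _).2 ⟨_, _, hi, rfl⟩), hF2 j ((hmem _ _).2 ⟨_, _, hj, rfl⟩)]
    exact e'.symm.lt_iff_lt.2 hij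
  have hinj : Function.Injective F := by
    have key : ∀ i j, i < j → F i ≠ F j := by
      intro i j hij hF
      rcases hi : w i with _ | ⟨_ | _, q⟩ <;> rcases hj : w j with _ | ⟨_ | _, q'⟩
      · rw [hF3 i hi, hF3 j hj] at hF; omega
      · obtain ⟨-, p, h3⟩ := h2 j _ hj; rw [← hF, hF3 i hi, hi] at h3; cases h3
      · obtain ⟨-, p, h3⟩ := h1 j _ hj; rw [← hF, hF3 i hi, hi] at h3; cases h3
      · obtain ⟨-, p, h3⟩ := h2 i _ hi; rw [hF, hF3 j hj, hj] at h3; cases h3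
      · exact (hm2 i j _ _ hi hj hij).ne hF
      · obtain ⟨-, p, h3⟩ := h2 i _ hi; obtain ⟨-, p', h4⟩ := h1 j _ hj
        rw [← hF, h3] at h4; simp at h4
      · obtain ⟨-, p, h3⟩ := h1 i _ hi; rw [hF, hF3 j hj, hj] at h3; cases h3
      · obtain ⟨-, p, h3⟩ := h1 i _ hi; obtain ⟨-, p', h4⟩ := h2 j _ hj
        rw [← hF, h3] at h4; simp at h4
      · exact (hm1 i j _ _ hi hj hij).ne hF
    intro i j hF
    by_contra hne
    rcases lt_or_gt_of_ne hne with h | h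
    · exact key i j h hF
    · exact key j i h hF.symm
  obtain ⟨π, hπ⟩ : ∃ π : Equiv.Perm (Fin n), ∀ i, π i = F i :=
    ⟨Equiv.ofBijective F (Finite.injective_iff_bijective.1 hinj), fun i => rfl⟩
  have hw1 : ∀ i, i < π i → ∃ q, w i = some (true, q) := by
    intro i hi
    rw [hπ] at hi
    rcases h : w i with _ | ⟨_ | _, q⟩
    · rw [hF3 i h] at hi; omega
    · exact absurd (h2 i q h).1 hi.not_gt
    · exact ⟨q, rfl⟩
  have hw2 : ∀ i, π i < i → ∃ q, w i = some (false, q) := by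
    intro i hi
    rw [hπ] at hi
    rcases h : w i with _ | ⟨_ | _, q⟩
    · rw [hF3 i h] at hi; omega
    · exact ⟨q, rfl⟩
    · exact absurd (h1 i q h).1 hi.not_gt
  refine ⟨π, ?_, fun i j hij hi hj => ?_, fun i j hij hi hj => ?_⟩
  · funext i
    rcases h : w i with _ | ⟨p, q⟩
    · rw [word_eq_none_iff, hπ, hF3 i h]
    · have hp : π i ≠ i ∧ (p = true ↔ i < π i) := by
        rw [hπ]
        cases p
        · have := (h2 i q h).1
          simp; omega
        · have := (h1 i q h).1
          simp; omega
      refine word_eq_some_iff.2 ⟨hp.1, hp.2, ?_⟩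
      have hk : π (π⁻¹ i) = i := perm_apply_inv_self π i
      rcases lt_trichotomy (π⁻¹ i) i with h3 | h3 | h3
      · obtain ⟨q', h4⟩ := hw1 (π⁻¹ i) (by rwa [hk])
        obtain ⟨-, p', h5⟩ := h1 _ _ h4
        rw [← hπ, hk, h] at h5
        simp_all
      · exact absurd ((inv_apply_eq_self_iff π i).1 h3) hp.1
      · obtain ⟨q', h4⟩ := hw2 (π⁻¹ i) (by rwa [hk])
        obtain ⟨-, p', h5⟩ := h2 _ _ h4
        rw [← hπ, hk, h] at h5
        simp only [Option.some.injEq, Prod.mk.injEq] at h5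
        rw [h5.2, iff_false_left Bool.false_ne_true]
        exact h3.not_gt
  · obtain ⟨q, hi'⟩ := hw1 i hi
    obtain ⟨q', hj'⟩ := hw1 j hj
    rw [hπ, hπ]
    exact hm1 i j q q' hi' hj' hij
  · obtain ⟨q, hi'⟩ := hw2 (π⁻¹ i) (by rwa [perm_apply_inv_self])
    obtain ⟨q', hj'⟩ := hw2 (π⁻¹ j) (by rwa [perm_apply_inv_self])
    by_contra hc
    have hlt : π⁻¹ j < π⁻¹ i := lt_of_le_of_ne (not_lt.1 hc) fun h => hij.ne' (π⁻¹.injective h)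
    have := hm2 _ _ _ _ hj' hi' hlt
    rw [← hπ, ← hπ, perm_apply_inv_self, perm_apply_inv_self] at this
    exact this.not_gt hij

open Classical in
/-- The valid words of length `n`. -/
noncomputable def validWords (n : ℕ) : Finset (Fin n → Letter) := univ.filter ValidWord

theorem mem_validWords {w : Fin n → Letter} : w ∈ validWords n ↔ ValidWord w := by
  classical
  rw [validWords, mem_filter, and_iff_right (mem_univ _)]

theorem bijOn_word_avoiding321 (n : ℕ) :
    Set.BijOn word (avoiding321 n : Set (Equiv.Perm (Fin n))) (validWords n) := by
  refine ⟨fun π hπ => ?_, fun π hπ σ hσ h => ?_, fun w hw => ?_⟩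
  · rw [mem_coe, mem_avoiding321_iff] at hπ
    rw [mem_coe, mem_validWords, validWord_word_iff]
    exact hπ.2.2
  · rw [mem_coe, mem_avoiding321_iff] at hπ hσ
    exact eq_of_word_eq h (hπ.1.apply_eq hσ.1 h) (hπ.2.1.apply_eq hσ.2.1 (word_inv_eq_word_inv h))
  · rw [mem_coe, mem_validWords] at hw
    obtain ⟨π, rfl, h1, h2⟩ := hw.exists_firstInFirstOut
    exact ⟨π, mem_coe.2 (mem_avoiding321_iff.2 ⟨h1, h2, validWord_word_iff.1 hw⟩), rfl⟩

theorem bijOn_word_unimodalNoncrossing (n : ℕ) :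
    Set.BijOn word (unimodalNoncrossing n : Set (Equiv.Perm (Fin n))) (validWords n) := by
  refine ⟨fun π hπ => ?_, fun π hπ σ hσ h => ?_, fun w hw => ?_⟩
  · rw [mem_coe, mem_unimodalNoncrossing_iff] at hπ
    rw [mem_coe, mem_validWords, validWord_word_iff]
    exact hπ.2.2
  · rw [mem_coe, mem_unimodalNoncrossing_iff] at hπ hσ
    exact eq_of_word_eq h (hπ.1.apply_eq hσ.1 h) (hπ.2.1.apply_eq hσ.2.1 (word_inv_eq_word_inv h))
  · rw [mem_coe, mem_validWords] at hw
    obtain ⟨σ, rfl, -, -⟩ := hw.exists_firstInFirstOut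
    -- Only the first-in-first-out matching is constructed directly; uncrossing it yields this one.
    obtain ⟨π, h, h1, h2⟩ := exists_lastInFirstOut σ
    rw [← h] at hw ⊢
    exact ⟨π, mem_coe.2 (mem_unimodalNoncrossing_iff.2 ⟨h1, h2, validWord_word_iff.1 hw⟩), rfl⟩

end ValidWords

/-! ### Statistics read from the word -/

section Statistics

variable {n : ℕ}

theorem fp_eq_card_word (π : Equiv.Perm (Fin n)) : fp π = #{i | word π i = none} := by
  simp only [fp, word_eq_none_iff]

theorem exc_eq_card_word (π : Equiv.Perm (Fin n)) :
    exc π = #{i | word π i = some (true, false) ∨ word π i = some (true, true)} := by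
  rw [exc]
  congr 1
  ext i
  simp only [mem_filter, mem_univ, true_and, word_eq_some_iff, Bool.false_eq_true, false_iff,
    true_iff]
  omega

theorem dexc_eq_card_word (π : Equiv.Perm (Fin n)) :
    dexc π = #{i | word π i = some (true, true)} := by
  -- A double excedance `i` is visible in the word at the middle point `π i`.
  refine card_bij (fun i _ => π i) (fun i hi => ?_) (fun i _ j _ h => π.injective h)
    fun i hi => ⟨π⁻¹ i, ?_, perm_apply_inv_self π i⟩
  · simp only [mem_filter, mem_univ, true_and, word_eq_some_iff, true_iff,
      perm_inv_apply_self] at hi ⊢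
    omega
  · simp only [mem_filter, mem_univ, true_and, word_eq_some_iff, true_iff,
      perm_apply_inv_self] at hi ⊢
    omega

theorem word_eq_some_true_false_iff {π : Equiv.Perm (Fin n)} {i : Fin n} :
    word π i = some (true, false) ↔ IsValley π i := by
  have h := inv_apply_eq_self_iff π i
  simp only [word_eq_some_iff, IsValley, Bool.false_eq_true, false_iff, true_iff]
  omega

/-- Each cycle is represented by its fixed point or by its only valley. -/
theorem cyc_eq_card_word {π : Equiv.Perm (Fin n)} (h : UniqueValleys π) :
    cyc π = #{i | word π i = none ∨ word π i = some (true, false)} := by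
  rw [cyc, ← Fintype.card_subtype, ← Nat.card_eq_fintype_card]
  symm
  refine Nat.card_eq_of_bijective
    (fun i => (Quotient.mk (Equiv.Perm.SameCycle.setoid π) i.1)) ⟨?_, ?_⟩
  · rintro ⟨i, hi⟩ ⟨j, hj⟩ hij
    have hij' : π.SameCycle i j := Quotient.exact hij
    rw [word_eq_none_iff, word_eq_some_true_false_iff] at hi hj
    refine Subtype.ext ?_
    rcases hi with hi | hi
    · exact hij'.eq_of_left hi
    · rcases hj with hj | hj
      · exact hij'.eq_of_right hj
      · exact h i j hij' hi hj
  · intro c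
    induction c using Quotient.inductionOn with
    | _ i =>
    obtain ⟨a, ha, hmin⟩ := exists_cycle_min π i
    refine ⟨⟨a, ?_⟩, Quotient.sound ha⟩
    rw [word_eq_none_iff, word_eq_some_true_false_iff]
    by_cases hfix : π a = a
    · exact Or.inl hfix
    · exact Or.inr (isValley_of_min hmin hfix)

/-- The contribution of a letter at height `h` to the number of inversions. -/
def Letter.inversions (h : ℕ) : Letter → ℕ
  | none => 0
  | some (true, false) => 3 * h + 1
  | some (false, true) => h - 1
  | some _ => 2 * h - 1

theorem upArcs_eq_card_strict_add (π : Equiv.Perm (Fin n)) (k : Fin n) :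
    upArcs π k = #{i | i < k ∧ k < π i} + if π⁻¹ k < k then 1 else 0 := by
  have h : (if π⁻¹ k < k then 1 else 0) =
      ∑ i : Fin n, if i = π⁻¹ k then (if i < k then 1 else 0) else 0 := by simp
  rw [h, upArcs, card_filter, card_filter, ← sum_add_distrib]
  refine sum_congr rfl fun i _ => ?_
  have : i = π⁻¹ k ↔ π i = k := by rw [eq_comm, Equiv.Perm.inv_eq_iff_eq, eq_comm]
  simp only [this]
  split_ifs <;> omega

theorem upArcs_eq_card_strict_down_add (π : Equiv.Perm (Fin n)) (k : Fin n) :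
    upArcs π k = #{i | π i < k ∧ k < i} + if π k < k then 1 else 0 := by
  have h : (if π k < k then 1 else 0) =
      ∑ i : Fin n, if i = k then (if π i < k then 1 else 0) else 0 := by simp
  rw [← downArcs_eq, h, card_filter, card_filter, ← sum_add_distrib]
  refine sum_congr rfl fun i _ => ?_
  split_ifs <;> omega

theorem inv_eq_sum_word {π : Equiv.Perm (Fin n)} (h1 : LastInFirstOut π)
    (h2 : LastInFirstOut π⁻¹) (h3 : ∀ j, ¬ IsNestedFixedPoint π j) :
    inv π = ∑ k, (word π k).inversions (upArcs π k) := by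
  -- An inversion is a pair of nested upper arcs (counted at the inner start), nested lower arcs (at
  -- the inner right end), or an overlapping upper and lower arc (at the later left end, ties going
  -- to the lower arc). Fixed points take no part because none is nested.
  have key : ∀ i j : Fin n, (if i < j ∧ π j < π i then 1 else 0) =
      (if j < π j then (if i < j ∧ j < π i then 1 else 0) else 0) +
      (if π i < i then (if π j < i ∧ i < j then 1 else 0) else 0) +
      (if π j < j then (if i ≤ π j ∧ π j < π i then 1 else 0) else 0) +
      (if i < π i then (if π j < i ∧ i < j then 1 else 0) else 0) := by
    intro i j
    have a1 := h1 i j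
    have a2 := h2 (π i) (π j)
    have a3 := h2 (π j) (π i)
    rw [perm_inv_apply_self, perm_inv_apply_self] at a2 a3
    have a4 : ¬ (π i = i ∧ i < j ∧ π j < i) := fun ⟨hf, hij, hji⟩ =>
      h3 i ⟨hf, π j, j, hji, hij, Or.inr rfl⟩
    have a5 : ¬ (π j = j ∧ i < j ∧ j < π i) := fun ⟨hf, hij, hji⟩ =>
      h3 j ⟨hf, i, π i, hij, hji, Or.inl rfl⟩
    have a6 : π i = π j → i = j := fun h => π.injective h
    clear h1 h2 h3
    split_ifs <;> omega
  have hinv : inv π = ∑ i, ∑ j, if i < j ∧ π j < π i then 1 else 0 := by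
    rw [inv, card_filter, ← univ_product_univ, sum_product]
  have s1 : ∑ i, ∑ j, (if j < π j then (if i < j ∧ j < π i then 1 else 0) else 0) =
      ∑ k, if k < π k then #{i | i < k ∧ k < π i} else 0 := by
    rw [sum_comm]
    refine sum_congr rfl fun k _ => ?_
    split_ifs
    · rw [card_filter]
    · simp
  have s2 : ∑ i, ∑ j, (if π i < i then (if π j < i ∧ i < j then 1 else 0) else 0) =
      ∑ k, if π k < k then #{j | π j < k ∧ k < j} else 0 := by
    refine sum_congr rfl fun k _ => ?_
    split_ifs
    · rw [card_filter]
    · simp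
  have s4 : ∑ i, ∑ j, (if i < π i then (if π j < i ∧ i < j then 1 else 0) else 0) =
      ∑ k, if k < π k then #{j | π j < k ∧ k < j} else 0 := by
    refine sum_congr rfl fun k _ => ?_
    split_ifs
    · rw [card_filter]
    · simp
  have s3 : ∑ i, ∑ j, (if π j < j then (if i ≤ π j ∧ π j < π i then 1 else 0) else 0) =
      ∑ k : Fin n, if k < π⁻¹ k then upArcs π (k + 1) else 0 := by
    rw [sum_comm, ← Equiv.sum_comp π fun k : Fin n => if k < π⁻¹ k then upArcs π (k + 1) else 0]
    refine sum_congr rfl fun k _ => ?_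
    rw [perm_inv_apply_self]
    split_ifs
    · rw [upArcs, card_filter]
      refine sum_congr rfl fun i _ => ?_
      split_ifs <;> omega
    · simp
  rw [hinv]
  simp only [key, sum_add_distrib]
  rw [s1, s2, s3, s4, ← sum_add_distrib, ← sum_add_distrib, ← sum_add_distrib]
  refine sum_congr rfl fun k _ => ?_
  have c1 := upArcs_eq_card_strict_add π k
  have c2 := upArcs_eq_card_strict_down_add π k
  have c3 := upArcs_succ π k
  have c4 := inv_apply_eq_self_iff π k
  rcases hw : word π k with _ | ⟨p, q⟩
  · rw [word_eq_none_iff] at hw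
    rw [c4.2 hw, hw]
    simp [Letter.inversions]
  · obtain ⟨b1, b2, b3⟩ := word_eq_some_iff.1 hw
    cases p <;> cases q <;>
      simp only [Letter.inversions, Bool.false_eq_true, false_iff, true_iff] at * <;>
      split_ifs at * <;> omega

end Statistics

/-! ### Weighted path sums, the continued fraction and Catalan numbers -/

section PathSums

variable {R : Type*} [CommRing R]

/-- The weight of a letter at height `h`, zero if the letter is not allowed there. -/
def stepWeight (x v w t q : R) (h : ℤ) : Letter → R
  | none => if h = 0 then x * t else 0
  | some (true, false) => v * t * q ^ (3 * h.toNat + 1)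
  | some (true, true) => if 1 ≤ h then v * w * q ^ (2 * h.toNat - 1) else 0
  | some (false, false) => if 1 ≤ h then q ^ (2 * h.toNat - 1) else 0
  | some (false, true) => if 1 ≤ h then q ^ (h.toNat - 1) else 0

/-- The weight of a word read from height `h`, zero if it does not end at height zero. -/
def wordWeight (x v w t q : R) {n : ℕ} (h : ℤ) (u : Fin n → Letter) : R :=
  (∏ i : Fin n, stepWeight x v w t q (h + wordHeight u i) (u i)) * if h + wordHeight u n = 0 then 1 else 0

/-- The sum of the weights of all words of length `n` read from height `h`. -/
def pathSum (x v w t q : R) (n : ℕ) (h : ℤ) : R :=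
  ∑ u : Fin n → Letter, wordWeight x v w t q h u

theorem wordHeight_zero {n : ℕ} (u : Fin n → Letter) : wordHeight u 0 = 0 := by
  simp [wordHeight]

theorem wordHeight_cons_succ {n : ℕ} (s : Letter) (u : Fin n → Letter) (p : ℕ) :
    wordHeight (Fin.cons s u : Fin (n + 1) → Letter) (p + 1) = s.rise + wordHeight u p := by
  simp [wordHeight, Fin.sum_univ_succ]

theorem wordWeight_cons (x v w t q : R) {n : ℕ} (h : ℤ) (s : Letter) (u : Fin n → Letter) :
    wordWeight x v w t q h (Fin.cons s u : Fin (n + 1) → Letter) =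
      stepWeight x v w t q h s * wordWeight x v w t q (h + s.rise) u := by
  simp only [wordWeight, Fin.prod_univ_succ, Fin.cons_zero, Fin.cons_succ, Fin.val_zero,
    Fin.val_succ, wordHeight_cons_succ, wordHeight_zero, add_zero, add_assoc, mul_assoc]

theorem pathSum_zero (x v w t q : R) (h : ℤ) :
    pathSum x v w t q 0 h = if h = 0 then 1 else 0 := by
  simp [pathSum, wordWeight, wordHeight_zero]

theorem pathSum_succ (x v w t q : R) (n : ℕ) (h : ℤ) :
    pathSum x v w t q (n + 1) h =
      ∑ s, stepWeight x v w t q h s * pathSum x v w t q n (h + s.rise) := by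
  rw [pathSum, ← (Fin.consEquiv fun _ : Fin (n + 1) => Letter).sum_comp, Fintype.sum_prod_type]
  refine sum_congr rfl fun s _ => ?_
  rw [pathSum, mul_sum]
  exact sum_congr rfl fun u _ => wordWeight_cons x v w t q h s u

theorem pathSum_succ_zero (x v w t q : R) (n : ℕ) :
    pathSum x v w t q (n + 1) 0 = x * t * pathSum x v w t q n 0 +
      v * t * q * pathSum x v w t q n 1 := by
  rw [pathSum_succ]
  simp [Fintype.sum_option, Fintype.sum_prod_type, stepWeight, Letter.rise]

theorem pathSum_succ_succ (x v w t q : R) (n h : ℕ) :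
    pathSum x v w t q (n + 1) (h + 1 : ℕ) =
      (1 + v * w) * q ^ (2 * h + 1) * pathSum x v w t q n (h + 1 : ℕ) +
      v * t * q ^ (3 * h + 4) * pathSum x v w t q n (h + 2 : ℕ) +
      q ^ h * pathSum x v w t q n h := by
  rw [pathSum_succ]
  have h1 : ¬ ((h : ℤ) + 1 = 0) := by omega
  have h2 : ((h : ℤ) + 1).toNat = h + 1 := by omega
  have h3 : 2 * (h + 1) - 1 = 2 * h + 1 := by omega
  have h4 : (h : ℤ) + 2 = h + 1 + 1 := by ring
  simp only [Fintype.sum_option, Fintype.sum_prod_type, Fintype.sum_bool, stepWeight, Letter.rise,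
    Nat.cast_add, Nat.cast_one, Nat.cast_ofNat, h1, h2, h3, h4, if_true, if_false, sub_self,
    Bool.false_eq_true, add_zero, zero_sub, sub_zero, add_neg_cancel_right, zero_mul, zero_add,
    show (1 : ℤ) ≤ h + 1 by omega, Nat.add_sub_cancel]
  ring

/-- Splitting off the first letter gives a recurrence in the length, and the factor `X` makes its
solution unique. It serves both for the continued fraction and for the Catalan count. -/
theorem coeff_eq_pathSum (x v w t q : R) (G : ℕ → PowerSeries R)
    (h0 : G 0 = 1 + PowerSeries.X *
      (PowerSeries.C (x * t) * G 0 + PowerSeries.C (v * t * q) * G 1))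
    (hs : ∀ h, G (h + 1) = PowerSeries.X *
      (PowerSeries.C ((1 + v * w) * q ^ (2 * h + 1)) * G (h + 1) +
        PowerSeries.C (v * t * q ^ (3 * h + 4)) * G (h + 2) + PowerSeries.C (q ^ h) * G h))
    (n h : ℕ) : PowerSeries.coeff n (G h) = pathSum x v w t q n h := by
  induction n generalizing h with
  | zero =>
    rw [pathSum_zero]
    cases h with
    | zero => rw [h0]; simp
    | succ h =>
      rw [hs, PowerSeries.coeff_zero_X_mul, if_neg (by omega)]
  | succ n ih =>
    cases h with
    | zero =>
      rw [h0, map_add, PowerSeries.coeff_succ_X_mul, map_add, PowerSeries.coeff_C_mul,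
        PowerSeries.coeff_C_mul, ih, ih, Nat.cast_zero, Nat.cast_one, pathSum_succ_zero]
      simp [PowerSeries.coeff_one]
    | succ h =>
      rw [hs, PowerSeries.coeff_succ_X_mul, map_add, map_add, PowerSeries.coeff_C_mul,
        PowerSeries.coeff_C_mul, PowerSeries.coeff_C_mul, ih, ih, ih, pathSum_succ_succ]

/-- The tail of the infinite continued fraction starting at level `h`. -/
noncomputable def jTail (d l : ℕ → R) (h : ℕ) : PowerSeries R :=
  PowerSeries.mk fun n => PowerSeries.coeff n (jConvergent d l n h)

theorem jTail_sub_dvd (d l : ℕ → R) (N h : ℕ) :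
    PowerSeries.X ^ (N + 1) ∣ jTail d l h - jConvergent d l N h := by
  rw [PowerSeries.X_pow_dvd_iff]
  intro m hm
  have h1 := PowerSeries.X_pow_dvd_iff.1 (jConvergent_sub_dvd d l m N h (by omega)) m (by omega)
  rw [map_sub, sub_eq_zero] at h1
  rw [map_sub, jTail, PowerSeries.coeff_mk, h1, sub_self]

/-- The defining equation of the convergents passes to the limit: modulo `X ^ (n + 1)` the tails can
be replaced by convergents. -/
theorem jTail_eq (d l : ℕ → R) (h : ℕ) :
    jTail d l h = 1 + PowerSeries.X * (PowerSeries.C (l h) * jTail d l h +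
      PowerSeries.C (d (h + 1)) * PowerSeries.X * jTail d l (h + 1) * jTail d l h) := by
  rw [← sub_eq_zero]
  ext n
  rw [map_zero]
  have h1 : (1 - PowerSeries.C (l h) * PowerSeries.X
        - PowerSeries.C (d (h + 1)) * PowerSeries.X ^ 2 * jConvergent d l n (h + 1)) *
        jConvergent d l (n + 1) h = 1 :=
    PowerSeries.mul_invOfUnit _ 1 (by simp)
  obtain ⟨e, he⟩ := jTail_sub_dvd d l n (h + 1)
  obtain ⟨e', he'⟩ := jTail_sub_dvd d l (n + 1) h
  refine PowerSeries.X_pow_dvd_iff.1 (?_ : PowerSeries.X ^ (n + 1) ∣ _) n (by omega)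
  refine ⟨PowerSeries.X * e' * (1 - PowerSeries.C (l h) * PowerSeries.X
    - PowerSeries.C (d (h + 1)) * PowerSeries.X ^ 2 * jConvergent d l n (h + 1)) -
    PowerSeries.C (d (h + 1)) * PowerSeries.X ^ 2 * e * jTail d l h, ?_⟩
  linear_combination h1 + (1 - PowerSeries.C (l h) * PowerSeries.X
    - PowerSeries.C (d (h + 1)) * PowerSeries.X ^ 2 * jConvergent d l n (h + 1)) * he' -
    PowerSeries.C (d (h + 1)) * PowerSeries.X ^ 2 * jTail d l h * he

theorem mk_pathSum_eq_jFraction (x v w t q : R) :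
    PowerSeries.mk (fun n => pathSum x v w t q n 0) =
      jFraction (fun h : ℕ => v * t * q ^ (4 * h - 3))
        (fun h : ℕ => if h = 0 then x * t else (1 + v * w) * q ^ (2 * h - 1)) := by
  set d : ℕ → R := fun h : ℕ => v * t * q ^ (4 * h - 3)
  set l : ℕ → R := fun h : ℕ => if h = 0 then x * t else (1 + v * w) * q ^ (2 * h - 1)
  -- A path from height `h + 1` stays at or above it (`jTail`), steps down with weight `q ^ h`, and
  -- continues from `h`.
  let G : ℕ → PowerSeries R := fun h => Nat.rec (jTail d l 0)
    (fun h g => jTail d l (h + 1) * PowerSeries.X * PowerSeries.C (q ^ h) * g) h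
  have hG : ∀ h, G (h + 1) = jTail d l (h + 1) * PowerSeries.X * PowerSeries.C (q ^ h) * G h :=
    fun h => rfl
  have hG0 : G 0 = jTail d l 0 := rfl
  have hl0 : l 0 = x * t := if_pos rfl
  have hl : ∀ h, l (h + 1) = (1 + v * w) * q ^ (2 * h + 1) := fun h => by
    simp only [l]; rw [if_neg (by omega)]; rfl
  -- The coefficient `d` is the weight of an up step times that of the matching down step: `(3 * h +
  -- 1) + h = 4 * (h + 1) - 3`.
  have hd : ∀ h, d (h + 1) = v * t * q ^ (3 * h + 1) * q ^ h := fun h => by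
    simp only [d]; rw [mul_assoc (v * t), ← pow_add]; congr 2; omega
  have key := coeff_eq_pathSum x v w t q G ?_ fun h => ?_
  · ext n
    rw [PowerSeries.coeff_mk, ← Nat.cast_zero, ← key n 0]
    rfl
  · have h1 := jTail_eq d l 0
    rw [hl0, hd, mul_zero, zero_add, pow_one, pow_zero, mul_one] at h1
    rw [show G 1 = _ from hG 0, hG0, pow_zero, map_one]
    linear_combination h1
  · have h1 := jTail_eq d l (h + 1)
    rw [hl, hd, map_mul _ _ (q ^ (h + 1)), show 3 * (h + 1) + 1 = 3 * h + 4 by ring] at h1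
    rw [hG (h + 1), hG h]
    linear_combination PowerSeries.X * PowerSeries.C (q ^ h) * G h * h1

theorem pathSum_one_eq_catalan (n : ℕ) : pathSum (1 : ℤ) 1 1 1 1 n 0 = catalan n := by
  set c : PowerSeries ℤ := PowerSeries.map (Nat.castRingHom ℤ) PowerSeries.catalanSeries with hcdef
  have hc : c = 1 + PowerSeries.X * c ^ 2 := by
    have h := congrArg (PowerSeries.map (Nat.castRingHom ℤ))
      PowerSeries.catalanSeries_sq_mul_X_add_one
    rw [map_add, map_mul, map_pow, map_one, PowerSeries.map_X] at h
    rw [hcdef]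
    linear_combination -h
  -- With unit weights the tail is `c` at level `0` and `c ^ 2` above, so the product of tails and
  -- down steps is `c * (X * c ^ 2) ^ h`.
  have key := coeff_eq_pathSum (1 : ℤ) 1 1 1 1 (fun h => PowerSeries.X ^ h * c ^ (2 * h + 1)) ?_
    (fun h => ?_) n 0
  · simpa [hcdef] using key.symm
  · simp only [mul_one, map_one, one_mul, pow_zero]
    linear_combination (1 + PowerSeries.X * c) * hc
  · simp only [mul_one, one_pow, one_mul, map_one, map_add]
    have : c ^ 2 = 1 + 2 * PowerSeries.X * c ^ 2 + PowerSeries.X ^ 2 * c ^ 4 := by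
      linear_combination (c + 1 + PowerSeries.X * c ^ 2) * hc
    linear_combination PowerSeries.X ^ (h + 1) * c ^ (2 * h + 1) * this

theorem wordWeight_zero_of_not_valid (x v w t q : R) {n : ℕ} {u : Fin n → Letter}
    (hu : ¬ ValidWord u) : wordWeight x v w t q 0 u = 0 := by
  rw [ValidWord, not_and_or, not_forall] at hu
  rw [wordWeight]
  simp only [zero_add]
  rcases hu with ⟨i, hi⟩ | hu
  · rw [prod_eq_zero (mem_univ i), zero_mul]
    rcases hs : u i with _ | ⟨_ | _, _ | _⟩ <;> rw [hs] at hi <;>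
      simp_all [Letter.Fits, stepWeight]
  · rw [if_neg hu, mul_zero]

theorem weight_eq_wordWeight (x v w t q : R) {n : ℕ} {π : Equiv.Perm (Fin n)}
    (hπ : π ∈ unimodalNoncrossing n) :
    x ^ fp π * v ^ exc π * w ^ dexc π * t ^ cyc π * q ^ inv π =
      wordWeight x v w t q 0 (word π) := by
  have hu : UniqueValleys π := by
    classical
    rw [unimodalNoncrossing, mem_filter] at hπ
    exact unimodalCycles_iff.1 hπ.2.1
  obtain ⟨h1, h2, h3⟩ := mem_unimodalNoncrossing_iff.1 hπ
  have hv := validWord_word_iff.2 h3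
  rw [wordWeight, zero_add, if_pos hv.2, mul_one, fp_eq_card_word, exc_eq_card_word,
    dexc_eq_card_word, cyc_eq_card_word hu, inv_eq_sum_word h1 h2 h3]
  simp only [card_filter, ← prod_pow_eq_pow_sum, ← prod_mul_distrib]
  refine prod_congr rfl fun i _ => ?_
  have hi := hv.1 i
  rw [zero_add]
  rw [wordHeight_word] at hi ⊢
  rcases hs : word π i with _ | ⟨_ | _, _ | _⟩ <;> rw [hs] at hi <;>
    simp_all [Letter.Fits, stepWeight, Letter.inversions]

theorem sum_weight_eq_pathSum (x v w t q : R) (n : ℕ) :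
    ∑ π ∈ unimodalNoncrossing n,
      x ^ fp π * v ^ exc π * w ^ dexc π * t ^ cyc π * q ^ inv π = pathSum x v w t q n 0 := by
  rw [sum_congr rfl fun π hπ => weight_eq_wordWeight x v w t q hπ, pathSum,
    ← sum_subset (subset_univ (validWords n)) fun u _ hu =>
      wordWeight_zero_of_not_valid x v w t q fun h => hu (mem_validWords.2 h)]
  have hb := bijOn_word_unimodalNoncrossing n
  exact sum_nbij word (fun π hπ => hb.mapsTo hπ) hb.injOn hb.surjOn fun _ _ => rfl

/-- The joint distribution of fixed points, excedances and double excedances on a set of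
permutations that the word maps bijectively to the valid words. -/
theorem card_filter_eq_of_bijOn_word {n : ℕ} {A : Finset (Equiv.Perm (Fin n))}
    (hA : Set.BijOn word (A : Set (Equiv.Perm (Fin n))) (validWords n)) (a b c : ℕ) :
    (A.filter fun π => fp π = a ∧ exc π = b ∧ dexc π = c).card =
      ((validWords n).filter fun u => #{i | u i = none} = a ∧
        #{i | u i = some (true, false) ∨ u i = some (true, true)} = b ∧
        #{i | u i = some (true, true)} = c).card := by
  refine card_nbij word (fun π hπ => ?_) (hA.injOn.mono fun π hπ => (mem_filter.1 hπ).1)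
    fun u hu => ?_
  · rw [mem_coe, mem_filter] at hπ ⊢
    rw [← fp_eq_card_word, ← exc_eq_card_word, ← dexc_eq_card_word]
    exact ⟨hA.mapsTo hπ.1, hπ.2⟩
  · rw [mem_coe, mem_filter] at hu
    obtain ⟨π, hπ, rfl⟩ := hA.surjOn (mem_coe.2 hu.1)
    rw [← fp_eq_card_word, ← exc_eq_card_word, ← dexc_eq_card_word] at hu
    exact ⟨π, mem_filter.2 ⟨hπ, hu.2⟩, rfl⟩

end PathSums
end PermCycles

open PermCycles
/-- The coefficients `x, v, w, t, q` are arbitrary elements of an arbitrary commutative ring; taking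
them to be the variables of a polynomial ring gives the identity for formal variables. The
truncated subtractions matter only at `h = 0`, where neither value is used. -/
theorem mainTheorem9 :
    (∀ n : ℕ, (unimodalNoncrossing n).card = catalan n) ∧
    (∀ n a b c : ℕ,
      ((unimodalNoncrossing n).filter fun π => fp π = a ∧ exc π = b ∧ dexc π = c).card =
        ((avoiding321 n).filter fun π => fp π = a ∧ exc π = b ∧ dexc π = c).card) ∧
    (∀ (R : Type*) [CommRing R] (x v w t q : R),
      PowerSeries.mk (fun n : ℕ => ∑ π ∈ unimodalNoncrossing n,
          x ^ fp π * v ^ exc π * w ^ dexc π * t ^ cyc π * q ^ inv π) =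
        jFraction (fun h : ℕ => v * t * q ^ (4 * h - 3))
          (fun h : ℕ => if h = 0 then x * t else (1 + v * w) * q ^ (2 * h - 1))) := by
  refine ⟨fun n => ?_, fun n a b c => ?_, fun R _ x v w t q => ?_⟩
  · have h := (sum_weight_eq_pathSum (1 : ℤ) 1 1 1 1 n).trans (pathSum_one_eq_catalan n)
    simpa using h
  · rw [card_filter_eq_of_bijOn_word (bijOn_word_unimodalNoncrossing n),
      card_filter_eq_of_bijOn_word (bijOn_word_avoiding321 n)]
  · simp only [sum_weight_eq_pathSum]
    exact mk_pathSum_eq_jFraction x v w t q
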